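/- Let $F$ be a field of characteristic $5$ and let $n_1,n_2\ge 1$ be integers. Let $\mathcal O=\mathcal O(2;(n_1,n_2))$ be the divided power algebra over $F$ with basis $x_1^{(a)}x_2^{(b)}$, $0\le a<5^{n_1}$, $0\le b<5^{n_2}$, and product $x_1^{(a)}x_2^{(b)}\cdot x_1^{(c)}x_2^{(d)}=\binom{a+c}{a}\binom{b+d}{b}x_1^{(a+c)}x_2^{(b+d)}$ (read as $0$ when $a+c\ge 5^{n_1}$ or $b+d\ge 5^{n_2}$), let $\partial_1,\partial_2$ be the derivations of $\mathcal O$ with $\partial_1(x_1^{(a)}x_2^{(b)})=x_1^{(a-1)}x_2^{(b)}$ and $\partial_2(x_1^{(a)}x_2^{(b)})=x_1^{(a)}x_2^{(b-1)}$ (where $x_i^{(-1)}=0$), and let $W=\mathcal O\partial_1\oplus\mathcal O\partial_2$ be the Lie algebra $W(2;(n_1,n_2))$, with $\operatorname{div}(f_1\partial_1+f_2\partial_2)=\partial_1(f_1)+\partial_2(f_2)$. The Melikian algebra is $\mathcal M(n_1,n_2)=W\oplus\mathcal O\oplus\widetilde W$, where $\widetilde W=\{\widetilde E : E\in W\}$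 is a copy of the vector space $W$, with the Lie bracket that extends the one of $W$ and satisfies, for $D,E\in W$ and $f,g,f_i,g_i\in\mathcal O$, $$[D,\widetilde E]=\widetilde{[D,E]}+2\operatorname{div}(D)\widetilde E,\qquad [D,f]=D(f)-2\operatorname{div}(D)f,\qquad [f,\widetilde E]=fE,$$ $$[f,g]=2\,\bigl(f D_g-gD_f\bigr)^{\sim}\ \text{ with } D_f=\partial_1(f)\partial_2-\partial_2(f)\partial_1,\qquad [f_1\tilde\partial_1+f_2\tilde\partial_2,\;g_1\tilde\partial_1+g_2\tilde\partial_2]=f_1g_2-f_2g_1.$$ Then $\mathcal M(n_1,n_2)$ possesses a nondegenerate symmetric $F$-bilinear form $b$ that is invariant, i.e. $b([x,y],z)=-b(y,[x,z])$ for all $x,y,z\in\mathcal M(n_1,n_2)$. -/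

import Mathlib

/-- Formal divided power series in two variables `x₁, x₂` over `F`:
`f` stands for `∑ f a b • x₁^(a) x₂^(b)`. -/
def DPSeries (F : Type*) : Type _ := ℕ → ℕ → F

namespace DPSeries

open Finset

theorem ext {F : Type*} {f g : DPSeries F} (h : ∀ a b, f a b = g a b) : f = g :=
  funext fun a => funext fun b => h a b

variable {F : Type*} [Field F]

instance : AddCommGroup (DPSeries F) := inferInstanceAs (AddCommGroup (ℕ → ℕ → F))

instance : Module F (DPSeries F) := inferInstanceAs (Module F (ℕ → ℕ → F))

theorem add_apply (f g : DPSeries F) (a b : ℕ) : (f + g) a b = f a b + g a b := rfl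

theorem zero_apply (a b : ℕ) : (0 : DPSeries F) a b = 0 := rfl

theorem smul_apply (c : F) (f : DPSeries F) (a b : ℕ) : (c • f) a b = c * f a b := rfl

/-- The product determined by
`x₁^(a) x₂^(b) * x₁^(c) x₂^(d) = C(a+c, a) C(b+d, b) x₁^(a+c) x₂^(b+d)`. -/
instance : Mul (DPSeries F) where
  mul f g := fun a b => ∑ p ∈ antidiagonal a, ∑ q ∈ antidiagonal b,
    ((p.1 + p.2).choose p.1 : F) * ((q.1 + q.2).choose q.1 : F) * f p.1 q.1 * g p.2 q.2

/-- The unit `x₁^(0) x₂^(0)`. -/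
instance : One (DPSeries F) where
  one := fun a b => if a = 0 ∧ b = 0 then 1 else 0

theorem mul_apply (f g : DPSeries F) (a b : ℕ) :
    (f * g) a b = ∑ p ∈ antidiagonal a, ∑ q ∈ antidiagonal b,
      ((p.1 + p.2).choose p.1 : F) * ((q.1 + q.2).choose q.1 : F) * f p.1 q.1 * g p.2 q.2 := rfl

theorem one_apply (a b : ℕ) : (1 : DPSeries F) a b = if a = 0 ∧ b = 0 then 1 else 0 := rfl

theorem sum_triple {M : Type*} [AddCommMonoid M] (n : ℕ) (G : ℕ → ℕ → ℕ → M) :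
    ∑ p ∈ antidiagonal n, ∑ q ∈ antidiagonal p.1, G q.1 q.2 p.2
      = ∑ p ∈ antidiagonal n, ∑ q ∈ antidiagonal p.2, G p.1 q.1 q.2 := by
  rw [Finset.sum_sigma', Finset.sum_sigma']
  refine Finset.sum_bij' (fun x _ => ⟨(x.2.1, x.2.2 + x.1.2), (x.2.2, x.1.2)⟩)
    (fun x _ => ⟨(x.1.1 + x.2.1, x.2.2), (x.1.1, x.2.1)⟩) ?_ ?_ ?_ ?_ ?_ <;>
  · rintro ⟨⟨a, b⟩, ⟨c, d⟩⟩ h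
    simp only [mem_sigma, HasAntidiagonal.mem_antidiagonal] at h
    obtain ⟨h₁, h₂⟩ := h
    simp_all
    try omega

theorem choose_triple (i j k : ℕ) :
    (i + j + k).choose (i + j) * (i + j).choose i
      = (i + (j + k)).choose i * (j + k).choose j := by
  have := Nat.choose_mul (n := i + j + k) (k := i + j) (s := i) (by omega)
  rw [this]
  congr 2 <;> omega

protected theorem mul_comm (f g : DPSeries F) : f * g = g * f := by
  apply ext
  intro a b
  rw [mul_apply, mul_apply, ← Finset.Nat.sum_antidiagonal_swap]
  refine Finset.sum_congr rfl fun p _ => ?_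
  rw [← Finset.Nat.sum_antidiagonal_swap]
  refine Finset.sum_congr rfl fun q _ => ?_
  simp only [Prod.fst_swap, Prod.snd_swap]
  rw [Nat.add_comm p.2, Nat.add_comm q.2, ← Nat.choose_symm_add, ← Nat.choose_symm_add]
  ring

protected theorem one_mul (f : DPSeries F) : 1 * f = f := by
  apply ext
  intro a b
  rw [mul_apply, Finset.sum_eq_single (0, a), Finset.sum_eq_single (0, b)]
  · simp [one_apply]
  · rintro ⟨i, j⟩ h h'
    have : i ≠ 0 := by
      rintro rfl
      simp_all
    simp [one_apply, this]
  · simp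
  · rintro ⟨i, j⟩ h h'
    have : i ≠ 0 := by
      rintro rfl
      simp_all
    simp [one_apply, this]
  · simp

protected theorem left_distrib (f g h : DPSeries F) : f * (g + h) = f * g + f * h := by
  apply ext
  intro a b
  simp only [mul_apply, add_apply, mul_add, Finset.sum_add_distrib]

protected theorem smul_mul (c : F) (f g : DPSeries F) : (c • f) * g = c • (f * g) := by
  apply ext
  intro a b
  simp only [mul_apply, smul_apply, Finset.mul_sum]
  refine Finset.sum_congr rfl fun p _ => Finset.sum_congr rfl fun q _ => ?_
  ring

protected theorem mul_assoc (f g h : DPSeries F) : f * g * h = f * (g * h) := by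
  apply ext
  intro a b
  let G : ℕ → ℕ → ℕ → ℕ → ℕ → ℕ → F := fun i j k i' j' k' =>
    ((i + j + k).choose (i + j) * (i + j).choose i : ℕ) *
      ((i' + j' + k').choose (i' + j') * (i' + j').choose i' : ℕ) * f i i' * g j j' * h k k'
  have hl : (f * g * h) a b = ∑ p ∈ antidiagonal a, ∑ r ∈ antidiagonal p.1,
      ∑ q ∈ antidiagonal b, ∑ s ∈ antidiagonal q.1, G r.1 r.2 p.2 s.1 s.2 q.2 := by
    simp only [mul_apply, Finset.mul_sum, Finset.sum_mul]
    refine Finset.sum_congr rfl fun p _ => ?_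
    rw [Finset.sum_comm]
    refine Finset.sum_congr rfl fun r hr => Finset.sum_congr rfl fun q _ =>
      Finset.sum_congr rfl fun s hs => ?_
    simp only [G]
    rw [← HasAntidiagonal.mem_antidiagonal.mp hr, ← HasAntidiagonal.mem_antidiagonal.mp hs]
    push_cast
    ring
  have hr : (f * (g * h)) a b = ∑ p ∈ antidiagonal a, ∑ r ∈ antidiagonal p.2,
      ∑ q ∈ antidiagonal b, ∑ s ∈ antidiagonal q.2, G p.1 r.1 r.2 q.1 s.1 s.2 := by
    simp only [mul_apply, Finset.mul_sum]
    refine Finset.sum_congr rfl fun p _ => ?_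
    rw [Finset.sum_comm]
    refine Finset.sum_congr rfl fun r hr => Finset.sum_congr rfl fun q _ =>
      Finset.sum_congr rfl fun s hs => ?_
    simp only [G]
    rw [choose_triple, choose_triple, ← HasAntidiagonal.mem_antidiagonal.mp hr, ← HasAntidiagonal.mem_antidiagonal.mp hs]
    push_cast
    ring
  rw [hl, hr]
  rw [sum_triple a fun i j k => ∑ q ∈ antidiagonal b, ∑ s ∈ antidiagonal q.1,
    G i j k s.1 s.2 q.2]
  refine Finset.sum_congr rfl fun p _ => Finset.sum_congr rfl fun r _ => ?_
  exact sum_triple b fun i' j' k' => G p.1 r.1 r.2 i' j' k'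

instance : CommRing (DPSeries F) :=
  { (inferInstance : AddCommGroup (DPSeries F)), (inferInstance : Mul (DPSeries F)),
    (inferInstance : One (DPSeries F)) with
    mul_assoc := DPSeries.mul_assoc
    mul_comm := DPSeries.mul_comm
    one_mul := DPSeries.one_mul
    mul_one := fun f => by rw [DPSeries.mul_comm, DPSeries.one_mul]
    left_distrib := DPSeries.left_distrib
    right_distrib := fun f g h => by
      rw [DPSeries.mul_comm, DPSeries.left_distrib, DPSeries.mul_comm h, DPSeries.mul_comm h]
    zero_mul := fun f => ext fun a b => by simp [mul_apply, zero_apply]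
    mul_zero := fun f => ext fun a b => by simp [mul_apply, zero_apply] }

instance : Algebra F (DPSeries F) :=
  Algebra.ofModule DPSeries.smul_mul fun c f g => by
    rw [DPSeries.mul_comm, DPSeries.smul_mul, DPSeries.mul_comm]

/-- `x₁^(a) x₂^(b) ↦ x₁^(a-1) x₂^(b)`. -/
def shift₁ (f : DPSeries F) : DPSeries F := fun a b => f (a + 1) b

/-- `x₁^(a) x₂^(b) ↦ x₁^(a) x₂^(b-1)`. -/
def shift₂ (f : DPSeries F) : DPSeries F := fun a b => f a (b + 1)

theorem mul_succ_left (f g : DPSeries F) (a b : ℕ) :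
    (f * g) (a + 1) b = (f * shift₁ g) a b
      + (g * shift₁ f) a b := by
  have key : ∀ (u v : DPSeries F) (a b : ℕ), (u * v) a b = ∑ p ∈ antidiagonal a,
      (a.choose p.1 : F) * ∑ q ∈ antidiagonal b,
        ((q.1 + q.2).choose q.1 : F) * u p.1 q.1 * v p.2 q.2 := by
    intro u v a b
    rw [mul_apply]
    refine Finset.sum_congr rfl fun p hp => ?_
    rw [HasAntidiagonal.mem_antidiagonal.mp hp, Finset.mul_sum]
    exact Finset.sum_congr rfl fun q _ => by ring
  rw [DPSeries.mul_comm g, key, key, key]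
  rw [Finset.sum_antidiagonal_choose_succ_mul (fun i j => ∑ q ∈ antidiagonal b,
    ((q.1 + q.2).choose q.1 : F) * f i q.1 * g j q.2) a]
  congr 1
  refine Finset.sum_congr rfl fun p hp => ?_
  rw [← HasAntidiagonal.mem_antidiagonal.mp hp, Nat.choose_symm_add]
  rfl

theorem mul_succ_right (f g : DPSeries F) (a b : ℕ) :
    (f * g) a (b + 1) = (f * shift₂ g) a b
      + (g * shift₂ f) a b := by
  have key : ∀ (u v : DPSeries F) (a b : ℕ), (u * v) a b = ∑ q ∈ antidiagonal b,
      (b.choose q.1 : F) * ∑ p ∈ antidiagonal a,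
        ((p.1 + p.2).choose p.1 : F) * u p.1 q.1 * v p.2 q.2 := by
    intro u v a b
    rw [mul_apply, Finset.sum_comm]
    refine Finset.sum_congr rfl fun q hq => ?_
    rw [HasAntidiagonal.mem_antidiagonal.mp hq, Finset.mul_sum]
    exact Finset.sum_congr rfl fun p _ => by ring
  rw [DPSeries.mul_comm g, key, key, key]
  rw [Finset.sum_antidiagonal_choose_succ_mul (fun i j => ∑ p ∈ antidiagonal a,
    ((p.1 + p.2).choose p.1 : F) * f p.1 i * g p.2 j) b]
  congr 1
  refine Finset.sum_congr rfl fun p hp => ?_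
  rw [← HasAntidiagonal.mem_antidiagonal.mp hp, Nat.choose_symm_add]
  rfl

theorem choose_cast_eq_zero [CharP F 5] {n a b : ℕ} (ha : a < 5 ^ n) (hb : b < 5 ^ n)
    (h : 5 ^ n ≤ a + b) : ((a + b).choose a : F) = 0 := by
  rw [CharP.cast_eq_zero_iff F 5]
  have hn : n ≠ 0 := by
    rintro rfl
    simp at ha hb h
    omega
  have hp : Nat.Prime 5 := by norm_num
  apply Nat.dvd_of_factorization_pos
  rw [Nat.add_comm a b, Nat.factorization_choose' hp (Nat.lt_succ_self _)]
  apply Finset.card_ne_zero_of_mem (a := n)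
  have hlog : n ≤ Nat.log 5 (b + a) := by
    apply Nat.le_log_of_pow_le (by norm_num)
    omega
  rw [Finset.mem_filter, Finset.mem_Ico, Nat.mod_eq_of_lt ha, Nat.mod_eq_of_lt hb]
  omega

end DPSeries

open DPSeries in
/-- The divided power algebra `O(2; (n₁, n₂))` in characteristic `5`: the span of the
`x₁^(a) x₂^(b)` with `a < 5 ^ n₁` and `b < 5 ^ n₂`. -/
def DPAlg (F : Type*) [Field F] [CharP F 5] (n₁ n₂ : ℕ) : Subalgebra F (DPSeries F) where
  carrier := {f | ∀ a b, ¬(a < 5 ^ n₁ ∧ b < 5 ^ n₂) → f a b = 0}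
  add_mem' := fun {f g} hf hg a b h => by rw [DPSeries.add_apply, hf a b h, hg a b h, add_zero]
  mul_mem' := fun {f g} hf hg a b h => by
    rw [mul_apply]
    refine Finset.sum_eq_zero fun p hp => Finset.sum_eq_zero fun q hq => ?_
    rw [Finset.HasAntidiagonal.mem_antidiagonal] at hp hq
    by_cases h₁ : p.1 < 5 ^ n₁ ∧ q.1 < 5 ^ n₂
    · by_cases h₂ : p.2 < 5 ^ n₁ ∧ q.2 < 5 ^ n₂
      · by_cases h₃ : a < 5 ^ n₁
        · have h₄ : 5 ^ n₂ ≤ q.1 + q.2 := by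
            rw [hq]
            exact not_lt.mp fun h' => h ⟨h₃, h'⟩
          rw [choose_cast_eq_zero h₁.2 h₂.2 h₄]
          ring
        · have h₄ : 5 ^ n₁ ≤ p.1 + p.2 := by
            rw [hp]
            exact not_lt.mp h₃
          rw [choose_cast_eq_zero h₁.1 h₂.1 h₄]
          ring
      · rw [hg _ _ h₂, mul_zero]
    · rw [hf _ _ h₁, mul_zero, zero_mul]
  algebraMap_mem' := fun c a b h => by
    rw [Algebra.algebraMap_eq_smul_one, DPSeries.smul_apply, one_apply, if_neg, mul_zero]
    rintro ⟨rfl, rfl⟩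
    exact h ⟨by positivity, by positivity⟩

namespace DPAlg

open DPSeries

variable {F : Type*} [Field F] [CharP F 5] {n₁ n₂ : ℕ}

/-- The derivation `∂₁`, with `∂₁ (x₁^(a) x₂^(b)) = x₁^(a-1) x₂^(b)`. -/
def d₁ : Derivation F (DPAlg F n₁ n₂) (DPAlg F n₁ n₂) :=
  Derivation.mk'
    { toFun := fun f => ⟨shift₁ f.1, fun a b h => f.2 (a + 1) b fun h' =>
        h ⟨lt_trans (Nat.lt_succ_self a) h'.1, h'.2⟩⟩
      map_add' := fun _ _ => rfl
      map_smul' := fun _ _ => rfl }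
    fun f g => Subtype.ext <| DPSeries.ext fun a b =>
      DPSeries.mul_succ_left f.1 g.1 a b

/-- The derivation `∂₂`, with `∂₂ (x₁^(a) x₂^(b)) = x₁^(a) x₂^(b-1)`. -/
def d₂ : Derivation F (DPAlg F n₁ n₂) (DPAlg F n₁ n₂) :=
  Derivation.mk'
    { toFun := fun f => ⟨shift₂ f.1, fun a b h => f.2 a (b + 1) fun h' =>
        h ⟨h'.1, lt_trans (Nat.lt_succ_self b) h'.2⟩⟩
      map_add' := fun _ _ => rfl
      map_smul' := fun _ _ => rfl }
    fun f g => Subtype.ext <| DPSeries.ext fun a b =>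
      DPSeries.mul_succ_right f.1 g.1 a b

theorem d₁_d₂ (f : DPAlg F n₁ n₂) : d₁ (d₂ f) = d₂ (d₁ f) := rfl

end DPAlg

/-- The free `O(2; (n₁, n₂))`-module on `∂₁, ∂₂`, where `(f₁, f₂)` stands for `f₁ ∂₁ + f₂ ∂₂`;
it underlies the Jacobson–Witt algebra `W(2; (n₁, n₂))`. -/
abbrev VecField (F : Type*) [Field F] [CharP F 5] (n₁ n₂ : ℕ) : Type _ :=
  DPAlg F n₁ n₂ × DPAlg F n₁ n₂

namespace VecField

open DPAlg

variable {F : Type*} [Field F] [CharP F 5] {n₁ n₂ : ℕ}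

/-- The value `D(f)` of the derivation `D` at `f`. -/
def app (D : VecField F n₁ n₂) (f : DPAlg F n₁ n₂) : DPAlg F n₁ n₂ :=
  D.1 * d₁ f + D.2 * d₂ f

/-- The commutator `[D, E]` of derivations. -/
def lieComm (D E : VecField F n₁ n₂) : VecField F n₁ n₂ :=
  (app D E.1 - app E D.1, app D E.2 - app E D.2)

/-- The commutator is the commutator of the operators on `O(2; (n₁, n₂))`. -/
theorem app_lieComm (D E : VecField F n₁ n₂) (f : DPAlg F n₁ n₂) :
    app (lieComm D E) f = app D (app E f) - app E (app D f) := by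
  simp only [app, lieComm, map_add, Derivation.leibniz, smul_eq_mul, d₁_d₂]
  ring

/-- The divergence `div(f₁ ∂₁ + f₂ ∂₂) = ∂₁(f₁) + ∂₂(f₂)`. -/
def div (D : VecField F n₁ n₂) : DPAlg F n₁ n₂ := d₁ D.1 + d₂ D.2

/-- The Hamiltonian derivation `D_f = ∂₁(f) ∂₂ - ∂₂(f) ∂₁`. -/
def ham (f : DPAlg F n₁ n₂) : VecField F n₁ n₂ := (-d₂ f, d₁ f)

end VecField

/-- The Melikian algebra `M(n₁, n₂) = W ⊕ O ⊕ W~`, where `O = O(2; (n₁, n₂))`,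
`W = W(2; (n₁, n₂))` and `W~` is a copy of the vector space `W`. The triple `(D, f, E)` stands for
`D + f + E~`. -/
def Melikian (F : Type*) [Field F] [CharP F 5] (n₁ n₂ : ℕ) : Type _ :=
  VecField F n₁ n₂ × DPAlg F n₁ n₂ × VecField F n₁ n₂

namespace Melikian

open DPAlg VecField

variable {F : Type*} [Field F] [CharP F 5] {n₁ n₂ : ℕ}

instance : AddCommGroup (Melikian F n₁ n₂) :=
  inferInstanceAs (AddCommGroup (VecField F n₁ n₂ × DPAlg F n₁ n₂ × VecField F n₁ n₂))

instance : Module F (Melikian F n₁ n₂) :=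
  inferInstanceAs (Module F (VecField F n₁ n₂ × DPAlg F n₁ n₂ × VecField F n₁ n₂))

/-- The component in `W`. -/
def vec (x : Melikian F n₁ n₂) : VecField F n₁ n₂ := x.1

/-- The component in `O`. -/
def fn (x : Melikian F n₁ n₂) : DPAlg F n₁ n₂ := x.2.1

/-- The component in `W~`. -/
def tilde (x : Melikian F n₁ n₂) : VecField F n₁ n₂ := x.2.2

/-- The antisymmetric bilinear product with
`[D, E]` the commutator of `W`,
`[D, E~] = [D, E]~ + 2 div(D) E~`,
`[D, f] = D(f) - 2 div(D) f`,
`[f, E~] = f E`,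
`[f, g] = 2 (f D_g - g D_f)~`,
`[(f₁ ∂₁ + f₂ ∂₂)~, (g₁ ∂₁ + g₂ ∂₂)~] = f₁ g₂ - f₂ g₁`. -/
instance : Bracket (Melikian F n₁ n₂) (Melikian F n₁ n₂) where
  bracket x y :=
    (lieComm x.vec y.vec + (x.fn • y.tilde - y.fn • x.tilde),
      (app x.vec y.fn - 2 * div x.vec * y.fn) - (app y.vec x.fn - 2 * div y.vec * x.fn)
        + (x.tilde.1 * y.tilde.2 - x.tilde.2 * y.tilde.1),
      (lieComm x.vec y.tilde + (2 * div x.vec) • y.tilde)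
        - (lieComm y.vec x.tilde + (2 * div y.vec) • x.tilde)
        + (2 : DPAlg F n₁ n₂) • (x.fn • ham y.fn - y.fn • ham x.fn))

theorem five_eq_zero : (5 : DPAlg F n₁ n₂) = 0 := by
  have h : (5 : F) = 0 := by exact_mod_cast CharP.cast_eq_zero F 5
  have h' := congrArg (algebraMap F (DPAlg F n₁ n₂)) h
  rwa [map_ofNat, map_zero] at h'

theorem ext {x y : Melikian F n₁ n₂} (h₁ : x.vec.1 = y.vec.1) (h₂ : x.vec.2 = y.vec.2)
    (h₃ : x.fn = y.fn) (h₄ : x.tilde.1 = y.tilde.1) (h₅ : x.tilde.2 = y.tilde.2) : x = y :=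
  Prod.ext (Prod.ext h₁ h₂) (Prod.ext h₃ (Prod.ext h₄ h₅))

variable (x y z : Melikian F n₁ n₂) (c : F)

theorem vec_add : (x + y).vec = x.vec + y.vec := rfl

theorem fn_add : (x + y).fn = x.fn + y.fn := rfl

theorem tilde_add : (x + y).tilde = x.tilde + y.tilde := rfl

theorem vec_smul : (c • x).vec = c • x.vec := rfl

theorem fn_smul : (c • x).fn = c • x.fn := rfl

theorem tilde_smul : (c • x).tilde = c • x.tilde := rfl

theorem vec_lie : ⁅x, y⁆.vec = lieComm x.vec y.vec + (x.fn • y.tilde - y.fn • x.tilde) := rfl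

theorem fn_lie : ⁅x, y⁆.fn =
    (app x.vec y.fn - 2 * div x.vec * y.fn) - (app y.vec x.fn - 2 * div y.vec * x.fn)
      + (x.tilde.1 * y.tilde.2 - x.tilde.2 * y.tilde.1) := rfl

theorem tilde_lie : ⁅x, y⁆.tilde =
    (lieComm x.vec y.tilde + (2 * div x.vec) • y.tilde)
      - (lieComm y.vec x.tilde + (2 * div y.vec) • x.tilde)
      + (2 : DPAlg F n₁ n₂) • (x.fn • ham y.fn - y.fn • ham x.fn) := rfl

theorem d₁_two : d₁ (2 : DPAlg F n₁ n₂) = 0 := by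
  exact_mod_cast (d₁ : Derivation F (DPAlg F n₁ n₂) (DPAlg F n₁ n₂)).map_natCast 2

theorem d₂_two : d₂ (2 : DPAlg F n₁ n₂) = 0 := by
  exact_mod_cast (d₂ : Derivation F (DPAlg F n₁ n₂) (DPAlg F n₁ n₂)).map_natCast 2

protected theorem add_lie : ⁅x + y, z⁆ = ⁅x, z⁆ + ⁅y, z⁆ := by
  apply ext <;>
  · simp only [vec_lie, fn_lie, tilde_lie, vec_add, fn_add, tilde_add, lieComm, app, div, ham,
      Prod.fst_add, Prod.snd_add, Prod.fst_sub, Prod.snd_sub, Prod.smul_fst, Prod.smul_snd,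
      smul_eq_mul, map_add]
    ring

protected theorem lie_add : ⁅x, y + z⁆ = ⁅x, y⁆ + ⁅x, z⁆ := by
  apply ext <;>
  · simp only [vec_lie, fn_lie, tilde_lie, vec_add, fn_add, tilde_add, lieComm, app, div, ham,
      Prod.fst_add, Prod.snd_add, Prod.fst_sub, Prod.snd_sub, Prod.smul_fst, Prod.smul_snd,
      smul_eq_mul, map_add]
    ring

protected theorem lie_smul : ⁅x, c • y⁆ = c • ⁅x, y⁆ := by
  apply ext <;>
  · simp only [vec_lie, fn_lie, tilde_lie, vec_smul, fn_smul, tilde_smul, lieComm, app, div, ham,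
      Prod.fst_add, Prod.snd_add, Prod.fst_sub, Prod.snd_sub, Prod.smul_fst, Prod.smul_snd,
      smul_eq_mul]
    simp only [Derivation.map_smul]
    simp only [Algebra.smul_def]
    ring

protected theorem lie_self : ⁅x, x⁆ = 0 := by
  apply ext
  · change ⁅x, x⁆.vec.1 = 0
    simp [vec_lie, lieComm]
  · change ⁅x, x⁆.vec.2 = 0
    simp [vec_lie, lieComm]
  · change ⁅x, x⁆.fn = 0
    rw [fn_lie]
    ring
  · change ⁅x, x⁆.tilde.1 = 0
    simp [tilde_lie]
  · change ⁅x, x⁆.tilde.2 = 0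
    simp [tilde_lie]

set_option maxHeartbeats 1600000 in
protected theorem leibniz_lie : ⁅x, ⁅y, z⁆⁆ = ⁅⁅x, y⁆, z⁆ + ⁅y, ⁅x, z⁆⁆ := by
  have h5 := five_eq_zero (F := F) (n₁ := n₁) (n₂ := n₂)
  have h10 : (10 : DPAlg F n₁ n₂) = 0 := by linear_combination 2 * h5
  apply ext <;>
  · simp only [vec_lie, fn_lie, tilde_lie, vec_add, fn_add, tilde_add, lieComm, app, div, ham,
      Prod.fst_add, Prod.snd_add, Prod.fst_sub, Prod.snd_sub, Prod.smul_fst, Prod.smul_snd,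
      smul_eq_mul, map_add, map_sub, map_neg, Derivation.leibniz, d₁_two, d₂_two, d₁_d₂]
    rw [← sub_eq_zero]
    ring_nf
    try simp only [h5, h10, mul_zero, add_zero, sub_zero, neg_zero]

instance : LieRing (Melikian F n₁ n₂) where
  add_lie := Melikian.add_lie
  lie_add := Melikian.lie_add
  lie_self := Melikian.lie_self
  leibniz_lie := Melikian.leibniz_lie

instance : LieAlgebra F (Melikian F n₁ n₂) where
  lie_smul c x y := Melikian.lie_smul x y c

end Melikian

/-!
The bracket with a vector field `D ∈ W` is its natural action on the three summands `W`, `O`, `W~`,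
twisted by `0`, `-2`, `2` times multiplication by `div D`. The determinant `det : W × W → O`
satisfies `D (det A B) = det [D, A] B + det A [D, B] + div D * det A B`. Hence pairing `W` with `W~`
by the determinant, and `O` with itself by multiplication, gives a symmetric `O`-valued pairing
`⟨y, z⟩` with `⟨[D, y], z⟩ + ⟨y, [D, z]⟩ = D ⟨y, z⟩ + div D * ⟨y, z⟩ = div (⟨y, z⟩ D)`: the
coefficient of `div D` is `2 - 1 = 1` on `W × W~`, and `-2 - 2 = 1` on `O × O` in characteristic
`5`. For the bracket with an element of `O` or `W~` the same sum is again a divergence. Taking the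
coefficient of the highest monomial kills divergences, so it turns the pairing into an invariant
form, which is nondegenerate because `x₁^(a) x₂^(b)` times the complementary monomial is `±` the
highest one.
-/

theorem cast_choose_prime_pow_sub_one (R : Type*) [Ring R] (p : ℕ) [Fact p.Prime] [CharP R p]
    {n a : ℕ} (ha : a < p ^ n) : ((p ^ n - 1).choose a : R) = (-1) ^ a := by
  induction a with
  | zero => simp
  | succ k ih =>
    have pascal : (p ^ n).choose (k + 1) = (p ^ n - 1).choose k + (p ^ n - 1).choose (k + 1) :=
      Nat.choose_eq_choose_pred_add (by omega) k.succ_pos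
    have vanish : ((p ^ n).choose (k + 1) : R) = 0 :=
      (CharP.cast_eq_zero_iff R p _).mpr
        ((Fact.out : p.Prime).dvd_choose_pow k.succ_ne_zero ha.ne)
    rw [pascal, Nat.cast_add, ih (Nat.lt_of_succ_lt ha)] at vanish
    rw [pow_succ, mul_neg_one]
    exact eq_neg_of_add_eq_zero_right vanish

namespace DPSeries

open Finset

variable {F : Type*} [Field F]

/-- The divided power monomial `x₁^(c) x₂^(d)`. -/
def monomial (c d : ℕ) : DPSeries F := fun a b => if a = c ∧ b = d then 1 else 0

theorem mul_monomial_apply (f : DPSeries F) (a b c d : ℕ) :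
    (f * monomial c d : DPSeries F) (a + c) (b + d) =
      ((a + c).choose a : F) * (b + d).choose b * f a b := by
  have eq_of_mem {k l : ℕ} {r : ℕ × ℕ} (hr : r ∈ antidiagonal (k + l)) (h : r.2 = l) :
      r = (k, l) := by
    rw [HasAntidiagonal.mem_antidiagonal] at hr
    exact Prod.ext (by omega) h
  rw [mul_apply, sum_eq_single_of_mem (a, c) (by simp),
    sum_eq_single_of_mem (b, d) (by simp)]
  · simp [monomial]
  · intro q hq hne
    rw [monomial, if_neg fun h => hne (eq_of_mem hq h.2), mul_zero]
  · intro p hp hne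
    refine sum_eq_zero fun q _ => ?_
    rw [monomial, if_neg fun h => hne (eq_of_mem hp h.1), mul_zero]

end DPSeries

namespace DPAlg

variable {F : Type*} [Field F] [CharP F 5] {n₁ n₂ : ℕ}

theorem monomial_mem {c d : ℕ} (hc : c < 5 ^ n₁) (hd : d < 5 ^ n₂) :
    DPSeries.monomial c d ∈ DPAlg F n₁ n₂ :=
  fun _ _ h => if_neg fun ⟨ha, hb⟩ => h ⟨ha ▸ hc, hb ▸ hd⟩

/-- The integral on `O(2; (n₁, n₂))`: the coefficient of the monomial of highest degree. It plays
the role of integration over a closed manifold, since it vanishes on divergences. -/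
def integral : DPAlg F n₁ n₂ →ₗ[F] F where
  toFun f := f.1 (5 ^ n₁ - 1) (5 ^ n₂ - 1)
  map_add' _ _ := rfl
  map_smul' _ _ := rfl

theorem integral_apply (f : DPAlg F n₁ n₂) : integral f = f.1 (5 ^ n₁ - 1) (5 ^ n₂ - 1) := rfl

theorem integral_d₁ (f : DPAlg F n₁ n₂) : integral (d₁ f) = 0 :=
  f.2 (5 ^ n₁ - 1 + 1) (5 ^ n₂ - 1) fun h => by omega

theorem integral_d₂ (f : DPAlg F n₁ n₂) : integral (d₂ f) = 0 :=
  f.2 (5 ^ n₁ - 1) (5 ^ n₂ - 1 + 1) fun h => by omega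

theorem integral_mul_monomial (f : DPAlg F n₁ n₂) {a b c d : ℕ} (hac : a + c = 5 ^ n₁ - 1)
    (hbd : b + d = 5 ^ n₂ - 1) (hm : DPSeries.monomial c d ∈ DPAlg F n₁ n₂) :
    integral (f * ⟨DPSeries.monomial c d, hm⟩) = (-1) ^ (a + b) * f.1 a b := by
  have : Fact (Nat.Prime 5) := ⟨Nat.prime_five⟩
  have h₁ : 0 < 5 ^ n₁ := by positivity
  have h₂ : 0 < 5 ^ n₂ := by positivity
  rw [integral_apply, ← hac, ← hbd]
  refine (DPSeries.mul_monomial_apply f.1 a b c d).trans ?_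
  rw [hac, hbd, cast_choose_prime_pow_sub_one F 5 (by omega),
    cast_choose_prime_pow_sub_one F 5 (by omega), pow_add]

theorem eq_zero_of_integral_mul {f : DPAlg F n₁ n₂} (h : ∀ g, integral (f * g) = 0) : f = 0 := by
  refine Subtype.ext (DPSeries.ext fun a b => ?_)
  by_cases hab : a < 5 ^ n₁ ∧ b < 5 ^ n₂
  · obtain ⟨c, hc⟩ : ∃ c, 5 ^ n₁ - 1 = a + c := Nat.exists_eq_add_of_le (by omega)
    obtain ⟨d, hd⟩ : ∃ d, 5 ^ n₂ - 1 = b + d := Nat.exists_eq_add_of_le (by omega)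
    have hm : DPSeries.monomial c d ∈ DPAlg F n₁ n₂ := monomial_mem (by omega) (by omega)
    have hcoeff := (integral_mul_monomial f hc.symm hd.symm hm).symm.trans (h _)
    exact (mul_eq_zero.mp hcoeff).resolve_left (pow_ne_zero _ (neg_ne_zero.mpr one_ne_zero))
  · exact f.2 a b hab

end DPAlg

namespace VecField

open DPAlg

variable {F : Type*} [Field F] [CharP F 5] {n₁ n₂ : ℕ}

theorem app_mul (D : VecField F n₁ n₂) (f g : DPAlg F n₁ n₂) :
    app D (f * g) = f * app D g + g * app D f := by
  simp only [app, Derivation.leibniz, smul_eq_mul]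
  ring

theorem div_smul (f : DPAlg F n₁ n₂) (D : VecField F n₁ n₂) :
    div (f • D) = app D f + f * div D := by
  simp only [div, app, Prod.smul_fst, Prod.smul_snd, smul_eq_mul, Derivation.leibniz]
  ring

theorem integral_div (D : VecField F n₁ n₂) : integral (div D) = 0 := by
  rw [div, map_add, integral_d₁, integral_d₂, add_zero]

/-- The volume form: the determinant `f₁ g₂ - f₂ g₁` of the vector fields `f₁ ∂₁ + f₂ ∂₂` and
`g₁ ∂₁ + g₂ ∂₂`, as an `O`-bilinear map. -/
def det : VecField F n₁ n₂ →ₗ[DPAlg F n₁ n₂] VecField F n₁ n₂ →ₗ[DPAlg F n₁ n₂] DPAlg F n₁ n₂ :=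
  LinearMap.mk₂ _ (fun D E => D.1 * E.2 - D.2 * E.1)
    (fun _ _ _ => by simp only [Prod.fst_add, Prod.snd_add]; ring)
    (fun _ _ _ => by simp only [Prod.smul_fst, Prod.smul_snd, smul_eq_mul]; ring)
    (fun _ _ _ => by simp only [Prod.fst_add, Prod.snd_add]; ring)
    (fun _ _ _ => by simp only [Prod.smul_fst, Prod.smul_snd, smul_eq_mul]; ring)

theorem det_apply (D E : VecField F n₁ n₂) : det D E = D.1 * E.2 - D.2 * E.1 := rfl

theorem det_swap (D E : VecField F n₁ n₂) : det D E = -det E D := by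
  rw [det_apply, det_apply]
  ring

theorem det_ham (D : VecField F n₁ n₂) (f : DPAlg F n₁ n₂) : det D (ham f) = app D f := by
  rw [det_apply, ham, app]
  ring

theorem lieComm_swap (D E : VecField F n₁ n₂) : lieComm D E = -lieComm E D :=
  Prod.ext (neg_sub _ _).symm (neg_sub _ _).symm

theorem app_det (D A B : VecField F n₁ n₂) :
    app D (det A B) = det (lieComm D A) B + det A (lieComm D B) + div D * det A B := by
  simp only [det_apply, lieComm, app, div, map_sub, Derivation.leibniz, smul_eq_mul]
  ring

theorem eq_zero_of_integral_det {D : VecField F n₁ n₂} (h : ∀ E, integral (det D E) = 0) :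
    D = 0 := by
  refine Prod.ext (eq_zero_of_integral_mul fun g => ?_) (eq_zero_of_integral_mul fun g => ?_)
  · simpa [det_apply] using h (0, g)
  · simpa [det_apply] using h (g, 0)

end VecField

namespace Melikian

open DPAlg VecField

variable {F : Type*} [Field F] [CharP F 5] {n₁ n₂ : ℕ}

/-- The inclusion of `W` in the Melikian algebra. -/
def ofVec (D : VecField F n₁ n₂) : Melikian F n₁ n₂ := (D, 0, 0)

/-- The inclusion of `O` in the Melikian algebra. -/
def ofFn (f : DPAlg F n₁ n₂) : Melikian F n₁ n₂ := (0, f, 0)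

/-- The inclusion `E ↦ E~` of `W~` in the Melikian algebra. -/
def ofTilde (E : VecField F n₁ n₂) : Melikian F n₁ n₂ := (0, 0, E)

@[simp] theorem vec_ofVec (D : VecField F n₁ n₂) : (ofVec D).vec = D := rfl

@[simp] theorem fn_ofVec (D : VecField F n₁ n₂) : (ofVec D).fn = 0 := rfl

@[simp] theorem tilde_ofVec (D : VecField F n₁ n₂) : (ofVec D).tilde = 0 := rfl

@[simp] theorem vec_ofFn (f : DPAlg F n₁ n₂) : (ofFn f).vec = 0 := rfl

@[simp] theorem fn_ofFn (f : DPAlg F n₁ n₂) : (ofFn f).fn = f := rfl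

@[simp] theorem tilde_ofFn (f : DPAlg F n₁ n₂) : (ofFn f).tilde = 0 := rfl

@[simp] theorem vec_ofTilde (E : VecField F n₁ n₂) : (ofTilde E).vec = 0 := rfl

@[simp] theorem fn_ofTilde (E : VecField F n₁ n₂) : (ofTilde E).fn = 0 := rfl

@[simp] theorem tilde_ofTilde (E : VecField F n₁ n₂) : (ofTilde E).tilde = E := rfl

theorem eq_ofVec_add_ofFn_add_ofTilde (x : Melikian F n₁ n₂) :
    x = ofVec x.vec + ofFn x.fn + ofTilde x.tilde := by
  apply ext <;> simp [vec_add, fn_add, tilde_add]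

theorem ofVec_lie (D : VecField F n₁ n₂) (y : Melikian F n₁ n₂) :
    ⁅ofVec D, y⁆ = ofVec (lieComm D y.vec) + ofFn (app D y.fn - 2 * div D * y.fn)
      + ofTilde (lieComm D y.tilde + (2 * div D) • y.tilde) := by
  apply ext <;> simp [vec_add, fn_add, tilde_add, vec_lie, fn_lie, tilde_lie,
    lieComm, app, ham]

theorem ofFn_lie (f : DPAlg F n₁ n₂) (y : Melikian F n₁ n₂) :
    ⁅ofFn f, y⁆ = ofVec (f • y.tilde) + ofFn (2 * div y.vec * f - app y.vec f)
      + ofTilde ((2 : DPAlg F n₁ n₂) • (f • ham y.fn - y.fn • ham f)) := by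
  apply ext <;> simp [vec_add, fn_add, tilde_add, vec_lie, fn_lie, tilde_lie,
    lieComm, app, ham, div]

theorem ofTilde_lie (E : VecField F n₁ n₂) (y : Melikian F n₁ n₂) :
    ⁅ofTilde E, y⁆ = ofVec (-y.fn • E) + ofFn (det E y.tilde)
      + ofTilde (-(lieComm y.vec E + (2 * div y.vec) • E)) := by
  apply ext <;> simp [vec_add, fn_add, tilde_add, vec_lie, fn_lie, tilde_lie,
    lieComm, app, ham, div, det_apply]

/-- The symmetric `O`-valued pairing whose integral is the invariant form. -/
def pairing (x y : Melikian F n₁ n₂) : DPAlg F n₁ n₂ :=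
  det x.vec y.tilde + x.fn * y.fn + det y.vec x.tilde

theorem pairing_comm (x y : Melikian F n₁ n₂) : pairing x y = pairing y x := by
  unfold pairing
  ring

theorem pairing_add_left (x y z : Melikian F n₁ n₂) :
    pairing (x + y) z = pairing x z + pairing y z := by
  simp only [pairing, vec_add, fn_add, tilde_add, map_add, LinearMap.add_apply]
  ring

theorem pairing_smul_left (c : F) (x y : Melikian F n₁ n₂) :
    pairing (c • x) y = c • pairing x y := by
  simp only [pairing, vec_smul, fn_smul, tilde_smul, LinearMap.map_smul_of_tower,
    LinearMap.smul_apply, smul_mul_assoc, smul_add]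

theorem pairing_ofVec (D : VecField F n₁ n₂) (y : Melikian F n₁ n₂) :
    pairing (ofVec D) y = det D y.tilde := by
  simp [pairing]

theorem pairing_ofFn (f : DPAlg F n₁ n₂) (y : Melikian F n₁ n₂) :
    pairing (ofFn f) y = f * y.fn := by
  simp [pairing]

theorem pairing_ofTilde (E : VecField F n₁ n₂) (y : Melikian F n₁ n₂) :
    pairing (ofTilde E) y = det y.vec E := by
  simp [pairing]

theorem pairing_ofVec_lie_add (D : VecField F n₁ n₂) (y z : Melikian F n₁ n₂) :
    pairing ⁅ofVec D, y⁆ z + pairing y ⁅ofVec D, z⁆ = div (pairing y z • D) := by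
  have app_pairing : app D (pairing y z) = app D (det y.vec z.tilde)
      + (y.fn * app D z.fn + z.fn * app D y.fn) + app D (det z.vec y.tilde) := by
    rw [← app_mul]
    simp only [pairing, app, map_add]
    ring
  rw [div_smul, app_pairing, app_det, app_det, pairing_comm y, ofVec_lie, ofVec_lie]
  simp only [pairing_add_left, pairing_ofVec, pairing_ofFn, pairing_ofTilde, map_add, map_smul,
    smul_eq_mul]
  rw [pairing]
  linear_combination -(div D * y.fn * z.fn) * five_eq_zero (F := F) (n₁ := n₁) (n₂ := n₂)

theorem pairing_ofFn_lie_add (f : DPAlg F n₁ n₂) (y z : Melikian F n₁ n₂) :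
    pairing ⁅ofFn f, y⁆ z + pairing y ⁅ofFn f, z⁆ =
      2 * (div ((f * y.fn) • z.vec) + div ((f * z.fn) • y.vec)) := by
  rw [div_smul, div_smul, app_mul, app_mul, pairing_comm y, ofFn_lie, ofFn_lie]
  simp only [pairing_add_left, pairing_ofVec, pairing_ofFn, pairing_ofTilde, map_sub, map_smul,
    LinearMap.smul_apply, smul_eq_mul, det_ham]
  linear_combination f * det_swap y.tilde z.tilde
    - (y.fn * app z.vec f + z.fn * app y.vec f) * five_eq_zero (F := F) (n₁ := n₁) (n₂ := n₂)

theorem pairing_ofTilde_lie_add (E : VecField F n₁ n₂) (y z : Melikian F n₁ n₂) :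
    pairing ⁅ofTilde E, y⁆ z + pairing y ⁅ofTilde E, z⁆ =
      -(div (det z.vec E • y.vec) + div (det y.vec E • z.vec)) := by
  have det_lieComm_swap : det (lieComm y.vec z.vec) E = -det (lieComm z.vec y.vec) E := by
    rw [lieComm_swap, map_neg, LinearMap.neg_apply]
  rw [div_smul, div_smul, app_det, app_det, pairing_comm y, ofTilde_lie, ofTilde_lie]
  simp only [pairing_add_left, pairing_ofVec, pairing_ofFn, pairing_ofTilde, map_add, map_neg,
    map_smul, LinearMap.smul_apply, smul_eq_mul]
  linear_combination det_lieComm_swap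

/-- The invariant form on the Melikian algebra. -/
def form : LinearMap.BilinForm F (Melikian F n₁ n₂) :=
  LinearMap.mk₂ F (fun x y => integral (pairing x y))
    (fun x y z => by rw [pairing_add_left, map_add])
    (fun c x y => by rw [pairing_smul_left, map_smul])
    (fun x y z => by rw [pairing_comm, pairing_add_left, map_add, pairing_comm y, pairing_comm z])
    (fun c x y => by rw [pairing_comm, pairing_smul_left, map_smul, pairing_comm y])

theorem form_apply (x y : Melikian F n₁ n₂) : form x y = integral (pairing x y) := rfl

theorem form_isSymm : (form : LinearMap.BilinForm F (Melikian F n₁ n₂)).IsSymm :=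
  ⟨fun x y => congrArg integral (pairing_comm x y)⟩

theorem form_lieInvariant :
    (form : LinearMap.BilinForm F (Melikian F n₁ n₂)).lieInvariant (Melikian F n₁ n₂) := by
  intro x y z
  have hVec : form ⁅ofVec x.vec, y⁆ z + form y ⁅ofVec x.vec, z⁆ = 0 := by
    rw [form_apply, form_apply, ← map_add, pairing_ofVec_lie_add, integral_div]
  have hFn : form ⁅ofFn x.fn, y⁆ z + form y ⁅ofFn x.fn, z⁆ = 0 := by
    rw [form_apply, form_apply, ← map_add, pairing_ofFn_lie_add, two_mul]
    simp only [map_add, integral_div, add_zero]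
  have hTilde : form ⁅ofTilde x.tilde, y⁆ z + form y ⁅ofTilde x.tilde, z⁆ = 0 := by
    rw [form_apply, form_apply, ← map_add, pairing_ofTilde_lie_add, map_neg, map_add,
      integral_div, integral_div, add_zero, neg_zero]
  rw [eq_neg_iff_add_eq_zero, eq_ofVec_add_ofFn_add_ofTilde x]
  simp only [add_lie, map_add, LinearMap.add_apply]
  linear_combination hVec + hFn + hTilde

theorem form_separatingLeft :
    (form : LinearMap.BilinForm F (Melikian F n₁ n₂)).SeparatingLeft := by
  intro x hx
  have hpair (y : Melikian F n₁ n₂) : integral (pairing y x) = 0 := by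
    rw [pairing_comm, ← form_apply, hx]
  have hVec : x.vec = 0 := eq_zero_of_integral_det fun E => by
    rw [← pairing_ofTilde, hpair]
  have hFn : x.fn = 0 := eq_zero_of_integral_mul fun g => by
    rw [mul_comm, ← pairing_ofFn, hpair]
  have hTilde : x.tilde = 0 := eq_zero_of_integral_det fun D => by
    rw [det_swap, ← pairing_ofVec, map_neg, hpair, neg_zero]
  exact Prod.ext hVec (Prod.ext hFn hTilde)

theorem form_nondegenerate :
    (form : LinearMap.BilinForm F (Melikian F n₁ n₂)).Nondegenerate := by
  have hrefl : LinearMap.IsRefl (form : LinearMap.BilinForm F (Melikian F n₁ n₂)) :=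
    form_isSymm.isRefl
  exact hrefl.nondegenerate_iff_separatingLeft.mpr form_separatingLeft

end Melikian

theorem mainTheorem7 (F : Type*) [Field F] [CharP F 5] (n₁ n₂ : ℕ) (hn₁ : 1 ≤ n₁) (hn₂ : 1 ≤ n₂) :
    ∃ b : LinearMap.BilinForm F (Melikian F n₁ n₂),
      b.Nondegenerate ∧ b.IsSymm ∧ b.lieInvariant (Melikian F n₁ n₂) :=
  ⟨Melikian.form, Melikian.form_nondegenerate, Melikian.form_isSymm, Melikian.form_lieInvariant⟩
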